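/- Let $g=\frac{\sqrt5-1}{2}$. Every rational $r\in(0,1)$ has exactly two finite continued fraction expansions $r=[0;S_0]=[0;S_1]$ with positive integer partial quotients, where the string $S_0$ has even length and $S_1$ has odd length. Write $\overline{S}$ for the infinite periodic string $SSS\cdots$, put $\alpha_0=[0;\overline{S_0}]$, $\alpha_1=[0;\overline{S_1}]$, and let $I_r=(\alpha_1,\alpha_0)$ be the \emph{quadratic interval} of $r$. Let $$\mathcal E=[0,g]\setminus\bigcup_{r\in\mathbb Q\cap(0,1)}I_r ,$$ and let $\mathbb Q_E$ be the set of those rationals $r\in(0,1)$ for which $I_r$ is maximal, that is, $I_r$ is a connected component of $[0,g]\setminus\mathcal E$. For $r\in\mathbb Q_E$ define the \emph{tuning window} $W_r=[\omega,\alpha_0)$ with $\omega=[0;S_1\overline{S_0}]$. The set of \emph{untuned parameters} is $$UT=[0,g]\setminus\bigcup_{r\in\mathbb Q_E}W_r .$$ Then the Hausdorff dimension of $UT$ is full: $$\mathrm{H.dim}\,UT=1 .$$ -/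

import Mathlib

open Set Filter Topology

noncomputable section

namespace AlphaCF

/-- The golden mean `g = (√5 - 1) / 2`. -/
def g : ℝ := (Real.sqrt 5 - 1) / 2

/-- The action `S · x` of a finite string `S` of positive integers on a real number `x`:
`(a₁, …, aₙ) · x = 1 / (a₁ + 1 / (a₂ + ⋯ + 1 / (aₙ + x)))`. -/
def act (S : List ℕ+) (x : ℝ) : ℝ := S.foldr (fun a y => 1 / (((a : ℕ) : ℝ) + y)) x

/-- The value `[0; S]` of a finite continued fraction. -/
def cfFinite (S : List ℕ+) : ℝ := act S 0

/-- The value `[0; a₀, a₁, a₂, …]` of an infinite continued fraction, the limit of its convergents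
(the limit exists for every sequence `a`, see `tendsto_cfInfinite`). -/
def cfInfinite (a : ℕ → ℕ+) : ℝ :=
  limUnder atTop (fun n : ℕ => cfFinite ((List.range n).map a))

/-- The infinite periodic string `S S S …` (for a nonempty finite string `S`). -/
def periodic (S : List ℕ+) : ℕ → ℕ+ := fun n => S.getD (n % S.length) 1

/-- The infinite string obtained by writing the finite string `S` in front of `a`. -/
def prepend (S : List ℕ+) (a : ℕ → ℕ+) : ℕ → ℕ+ :=
  fun n => if n < S.length then S.getD n 1 else a (n - S.length)

/-- `S₀` and `S₁` are the continued fraction expansions of the rational `r` of even and of odd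
length. Every rational `r` in `(0, 1)` has exactly one such pair `(S₀, S₁)`. -/
def IsExpansionPair (r : ℚ) (S₀ S₁ : List ℕ+) : Prop :=
  Even S₀.length ∧ Odd S₁.length ∧ cfFinite S₀ = (r : ℝ) ∧ cfFinite S₁ = (r : ℝ)

/-- The quadratic interval `I_r = (α₁, α₀)`, with `α₁ = [0; S₁ S₁ S₁ …]` and
`α₀ = [0; S₀ S₀ S₀ …]`. -/
def quadraticInterval (r : ℚ) : Set ℝ :=
  {x | ∃ S₀ S₁ : List ℕ+, IsExpansionPair r S₀ S₁ ∧
    x ∈ Ioo (cfInfinite (periodic S₁)) (cfInfinite (periodic S₀))}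

/-- The bifurcation set: the complement in `[0, g]` of all quadratic intervals `I_r`,
`r` rational in `(0, 1)`. -/
def bifurcationSet : Set ℝ :=
  Icc 0 g \ ⋃ (r : ℚ) (_ : 0 < r ∧ r < 1), quadraticInterval r

/-- The set of extremal rational values: those `r` in `(0, 1)` for which `I_r` is a maximal
quadratic interval, that is, a connected component of the complement in `[0, g]` of the
bifurcation set. -/
def extremalRationals : Set ℚ :=
  {r | 0 < r ∧ r < 1 ∧ (r : ℝ) ∈ Icc 0 g \ bifurcationSet ∧
    quadraticInterval r = connectedComponentIn (Icc 0 g \ bifurcationSet) (r : ℝ)}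

/-- The tuning window `W_r = [ω, α₀)`, with `ω = [0; S₁ S₀ S₀ S₀ …]` and
`α₀ = [0; S₀ S₀ S₀ …]`. It is used for extremal `r` only. -/
def tuningWindow (r : ℚ) : Set ℝ :=
  {x | ∃ S₀ S₁ : List ℕ+, IsExpansionPair r S₀ S₁ ∧
    x ∈ Ico (cfInfinite (prepend S₁ (periodic S₀))) (cfInfinite (periodic S₀))}

/-- The set of untuned parameters: the complement in `[0, g]` of all tuning windows. -/
def untuned : Set ℝ := Icc 0 g \ ⋃ r ∈ extremalRationals, tuningWindow r

theorem act_mem (S : List ℕ+) {x : ℝ} (hx : x ∈ Icc (0 : ℝ) 1) : act S x ∈ Icc (0 : ℝ) 1 := by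
  induction S with
  | nil => exact hx
  | cons a S ih =>
    have ha : (1 : ℝ) ≤ ((a : ℕ) : ℝ) := by exact_mod_cast a.pos
    have h0 : 0 ≤ act S x := ih.1
    change 1 / (((a : ℕ) : ℝ) + act S x) ∈ Icc (0 : ℝ) 1
    refine ⟨by positivity, ?_⟩
    rw [div_le_one (by positivity)]
    linarith

theorem abs_step (a u v : ℝ) (ha : 1 ≤ a) (hu : 0 ≤ u) (hv : 0 ≤ v) :
    |1 / (a + u) - 1 / (a + v)| = |u - v| / ((a + u) * (a + v)) := by
  have h1 : 0 < a + u := by linarith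
  have h2 : 0 < a + v := by linarith
  have h : 1 / (a + u) - 1 / (a + v) = (v - u) / ((a + u) * (a + v)) := by
    field_simp
    ring
  rw [h, abs_div, abs_of_pos (mul_pos h1 h2), abs_sub_comm]

theorem abs_act_sub_le {x y : ℝ} (hx : x ∈ Icc (0 : ℝ) 1) (hy : y ∈ Icc (0 : ℝ) 1) :
    ∀ S : List ℕ+, |act S x - act S y| ≤ 2 * (1 / 2 : ℝ) ^ S.length
  | [] => by
    have : |x - y| ≤ 2 := abs_le.2 ⟨by linarith [hx.1, hy.2], by linarith [hx.2, hy.1]⟩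
    simpa [act] using this
  | [a] => by
    have h1 := act_mem [a] hx
    have h2 := act_mem [a] hy
    have : |act [a] x - act [a] y| ≤ 1 :=
      abs_le.2 ⟨by linarith [h1.1, h2.2], by linarith [h1.2, h2.1]⟩
    simpa using this
  | a :: b :: S => by
    have ih := abs_act_sub_le hx hy S
    have ha : (1 : ℝ) ≤ ((a : ℕ) : ℝ) := by exact_mod_cast a.pos
    have hb : (1 : ℝ) ≤ ((b : ℕ) : ℝ) := by exact_mod_cast b.pos
    have hu := (act_mem S hx).1
    have hv := (act_mem S hy).1
    have hu' := (act_mem (b :: S) hx).1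
    have hv' := (act_mem (b :: S) hy).1
    have e1 := abs_step _ _ _ ha hu' hv'
    have e2 := abs_step _ _ _ hb hu hv
    change |1 / (((a : ℕ) : ℝ) + 1 / (((b : ℕ) : ℝ) + act S x))
      - 1 / (((a : ℕ) : ℝ) + 1 / (((b : ℕ) : ℝ) + act S y))| ≤ _
    change |1 / (((a : ℕ) : ℝ) + 1 / (((b : ℕ) : ℝ) + act S x))
      - 1 / (((a : ℕ) : ℝ) + 1 / (((b : ℕ) : ℝ) + act S y))| =
      |1 / (((b : ℕ) : ℝ) + act S x) - 1 / (((b : ℕ) : ℝ) + act S y)| /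
      ((((a : ℕ) : ℝ) + 1 / (((b : ℕ) : ℝ) + act S x)) *
        (((a : ℕ) : ℝ) + 1 / (((b : ℕ) : ℝ) + act S y))) at e1
    rw [e1, e2, div_div, div_le_iff₀ (by positivity)]
    have key : ∀ p : ℝ, 0 ≤ p →
        2 ≤ (((b : ℕ) : ℝ) + p) * (((a : ℕ) : ℝ) + 1 / (((b : ℕ) : ℝ) + p)) := by
      intro p hp
      have : (((b : ℕ) : ℝ) + p) * (((a : ℕ) : ℝ) + 1 / (((b : ℕ) : ℝ) + p))
          = (((b : ℕ) : ℝ) + p) * ((a : ℕ) : ℝ) + 1 := by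
        have : ((b : ℕ) : ℝ) + p ≠ 0 := by positivity
        field_simp
      rw [this]
      nlinarith
    have h4 := mul_le_mul (key _ hu) (key _ hv) (by norm_num) (by positivity)
    have hp : (0 : ℝ) ≤ (1 / 2 : ℝ) ^ S.length := by positivity
    calc |act S x - act S y| ≤ 2 * (1 / 2 : ℝ) ^ S.length := ih
      _ = 2 * (1 / 2 : ℝ) ^ (a :: b :: S).length * (2 * 2) := by
        simp only [List.length_cons, pow_succ]; ring
      _ ≤ 2 * (1 / 2 : ℝ) ^ (a :: b :: S).length * _ :=
        mul_le_mul_of_nonneg_left h4 (by positivity)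
      _ = _ := by ring

/-- Every infinite continued fraction with positive integer partial quotients converges. -/
theorem tendsto_cfInfinite (a : ℕ → ℕ+) :
    Tendsto (fun n : ℕ => cfFinite ((List.range n).map a)) atTop (𝓝 (cfInfinite a)) := by
  have hc : CauchySeq (fun n : ℕ => cfFinite ((List.range n).map a)) := by
    refine cauchySeq_of_le_geometric (1 / 2) 2 (by norm_num) fun n => ?_
    have h0 : (0 : ℝ) ∈ Icc (0 : ℝ) 1 := by simp
    have h := abs_act_sub_le h0 (act_mem [a n] h0) ((List.range n).map a)
    have e : cfFinite ((List.range (n + 1)).map a) =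
        act ((List.range n).map a) (act [a n] 0) := by
      simp [cfFinite, act, List.range_succ]
    rw [Real.dist_eq, e]
    simpa [cfFinite] using h
  exact hc.tendsto_limUnder

end AlphaCF

end

/-!
A real `x = [0; N, a₁, a₂, …]` whose later digits are much smaller than `N` lies in no tuning window
at all (`notMem_tuningWindow`): a point of `[ω, α₀)` is of the form `S · y` with `S` one of the two
expansions of `r` and `y ∈ [0, α₀]`, so that `y` is a tail of `x` and has a small first digit, hence
is large, whereas `α₀` starts with a digit close to `N`. Hence `UT` contains the image of the set of
all `[0; a₁, a₂, …]` with digits at most `M = N - 3` under the map `x ↦ 1 / (N + x)`, which has a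
Lipschitz inverse, and it suffices that the dimension of that set tends to `1` as `M → ∞`, a theorem
of Jarník.

For the latter let `|I_w|` be the length of the cylinder of the word `w`. The subcylinders `I_{wa}`
with `a ≤ M` fill `I_w` up to a proportion `O(1 / M)`, and each has at most half its length. So for
`s < 1` and `M` large, `|I_w| ^ s ≤ ∑_{a ≤ M} |I_{wa}| ^ s` (`rpow_cylLength_le_sum`). This
forces any countable cover by cylinders to have `∑ |I_w| ^ s ≥ 1` (`le_tsum_of_cover`). Points
with bounded digits that lie in distinct subcylinders of `I_w` have a distance comparable to `|I_w|`
(`cylLength_le_of_ne`), so each set of a cover can be replaced by a cylinder of comparable length,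
and the `s`-dimensional Hausdorff measure is positive (`le_dimH_boundedDigits`).
-/

open MeasureTheory
open scoped ENNReal NNReal

namespace AlphaCF

/-! ### Infinite continued fractions -/

theorem act_append (S T : List ℕ+) (x : ℝ) : act (S ++ T) x = act S (act T x) := by
  simp [act]

theorem act_cons (a : ℕ+) (S : List ℕ+) (x : ℝ) :
    act (a :: S) x = 1 / (((a : ℕ) : ℝ) + act S x) := rfl

theorem one_le_cast (a : ℕ+) : (1 : ℝ) ≤ ((a : ℕ) : ℝ) := by exact_mod_cast a.pos

theorem cfInfinite_mem_Icc (a : ℕ → ℕ+) : cfInfinite a ∈ Icc (0 : ℝ) 1 :=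
  isClosed_Icc.mem_of_tendsto (tendsto_cfInfinite a)
    (Eventually.of_forall fun _ => act_mem _ (by simp))

theorem cfInfinite_succ (a : ℕ → ℕ+) :
    cfInfinite a = 1 / (((a 0 : ℕ) : ℝ) + cfInfinite fun k => a (k + 1)) := by
  have hpos : ((a 0 : ℕ) : ℝ) + cfInfinite (fun k => a (k + 1)) ≠ 0 := by
    have := one_le_cast (a 0)
    have := (cfInfinite_mem_Icc fun k => a (k + 1)).1
    positivity
  have h1 := (tendsto_cfInfinite a).comp (tendsto_add_atTop_nat 1)
  have h2 := (tendsto_const_nhds (x := (1 : ℝ))).div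
    ((tendsto_cfInfinite fun k => a (k + 1)).const_add ((a 0 : ℕ) : ℝ)) hpos
  refine tendsto_nhds_unique h1 (h2.congr fun n => ?_)
  simp [Function.comp_def, cfFinite, List.range_succ_eq_map, act_cons]

theorem cfInfinite_mem_Ioo (a : ℕ → ℕ+) : cfInfinite a ∈ Ioo (0 : ℝ) 1 := by
  have hpos : ∀ b : ℕ → ℕ+, 0 < cfInfinite b := fun b => by
    rw [cfInfinite_succ]
    have := one_le_cast (b 0)
    have := (cfInfinite_mem_Icc fun k => b (k + 1)).1
    positivity
  refine ⟨hpos a, ?_⟩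
  rw [cfInfinite_succ]
  have h1 := one_le_cast (a 0)
  have h2 := hpos fun k => a (k + 1)
  rw [div_lt_one (by linarith)]
  linarith

theorem cfInfinite_eq_act (a : ℕ → ℕ+) (n : ℕ) :
    cfInfinite a = act ((List.range n).map a) (cfInfinite fun k => a (k + n)) := by
  induction n generalizing a with
  | zero => simp [act]
  | succ n ih =>
    rw [cfInfinite_succ, ih fun k => a (k + 1), List.range_succ_eq_map]
    simp [act_cons, Function.comp_def, add_assoc]

theorem cfInfinite_prepend (S : List ℕ+) (a : ℕ → ℕ+) :
    cfInfinite (prepend S a) = act S (cfInfinite a) := by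
  rw [cfInfinite_eq_act _ S.length]
  congr 1
  · refine List.ext_getElem (by simp) fun n h1 h2 => ?_
    simp [prepend, h2]
  · simp [prepend]

theorem cfInfinite_periodic (S : List ℕ+) :
    cfInfinite (periodic S) = act S (cfInfinite (periodic S)) := by
  conv_lhs => rw [cfInfinite_eq_act _ S.length]
  congr 1
  · refine List.ext_getElem (by simp) fun n h1 h2 => ?_
    simp [periodic, Nat.mod_eq_of_lt h2, h2]
  · change _ = cfInfinite fun k => periodic S k
    simp [periodic]

theorem continuousOn_act (S : List ℕ+) : ContinuousOn (act S) (Icc 0 1) := by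
  induction S with
  | nil => exact continuousOn_id
  | cons a S ih =>
    refine ContinuousOn.div continuousOn_const (continuousOn_const.add ih) fun x hx => ?_
    have := one_le_cast a
    have := (act_mem S hx).1
    positivity

/-- An infinite expansion has its digits determined by its value: since its tails lie strictly
between `0` and `1`, it can only be written as `S · y` with `y ∈ [0, 1]` if its digits start
with `S`. -/
theorem eq_of_cfInfinite_eq_act (S : List ℕ+) (a : ℕ → ℕ+) {y : ℝ} (hy : y ∈ Icc (0 : ℝ) 1)
    (h : cfInfinite a = act S y) :
    (List.range S.length).map a = S ∧ y = cfInfinite fun k => a (k + S.length) := by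
  induction S generalizing a with
  | nil => exact ⟨rfl, h.symm⟩
  | cons b S ih =>
    rw [cfInfinite_succ, act_cons] at h
    have hu := act_mem S hy
    have hv := cfInfinite_mem_Ioo fun k => a (k + 1)
    rw [one_div, one_div, inv_inj] at h
    have hab : a 0 = b := by
      have h1 : (a 0 : ℕ) < (b : ℕ) + 1 := by
        have : ((a 0 : ℕ) : ℝ) < ((b : ℕ) : ℝ) + 1 := by linarith [hu.2, hv.1]
        exact_mod_cast this
      have h2 : (b : ℕ) < (a 0 : ℕ) + 1 := by
        have : ((b : ℕ) : ℝ) < ((a 0 : ℕ) : ℝ) + 1 := by linarith [hu.1, hv.2]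
        exact_mod_cast this
      exact PNat.eq (by omega)
    rw [hab] at h
    obtain ⟨h1, h2⟩ := ih (fun k => a (k + 1)) (add_left_cancel h)
    refine ⟨?_, ?_⟩
    · rw [List.length_cons, List.range_succ_eq_map]
      simpa [hab, Function.comp_def] using h1
    · simpa [add_assoc] using h2

/-! ### Countable covers by cylinders -/

/-- If a weight `L` on finite words satisfies `L w ≤ ∑ L (w a)`, the sum being over the letters `a`
of a finite alphabet, then any countable family of cylinders that covers all infinite words has
total weight at least `L []`. Otherwise one could choose letters one at a time, so that the
cylinders of the family inside the current cylinder never have enough weight to cover it, and the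
infinite word so obtained would not be covered. -/
theorem le_tsum_of_cover {α : Type*} (A : Finset α) (L : List α → ℝ≥0∞)
    (hL : ∀ w, L w ≤ ∑ a ∈ A, L (w ++ [a])) (u : ℕ → List α)
    (hu : ∀ x : ℕ → α, (∀ k, x k ∈ A) → ∃ n, u n = (List.range (u n).length).map x) :
    L [] ≤ ∑' n, L (u n) := by
  classical
  set T : List α → ℝ≥0∞ := fun w => ∑' n, if w <+: u n then L (u n) else 0 with hT
  have hT0 : T [] = ∑' n, L (u n) := by simp [hT]
  have hTsum : ∀ w, ∑ a ∈ A, T (w ++ [a]) ≤ T w := fun w => by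
    rw [hT]
    dsimp only
    rw [← Summable.tsum_finsetSum fun _ _ => ENNReal.summable]
    refine ENNReal.tsum_le_tsum fun n => ?_
    by_cases hw : ∃ a ∈ A, w ++ [a] <+: u n
    · obtain ⟨a, ha, hw⟩ := hw
      rw [Finset.sum_eq_single_of_mem a ha, if_pos hw,
        if_pos ((List.prefix_append w [a]).trans hw)]
      intro b _ hb
      refine if_neg fun h => hb ?_
      have := List.IsPrefix.eq_of_length (List.prefix_of_prefix_length_le h hw (by simp)) (by simp)
      simpa using this
    · push Not at hw
      rw [Finset.sum_eq_zero fun a ha => if_neg (hw a ha)]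
      exact zero_le
  rw [← hT0]
  by_contra! hlt
  have step : ∀ w : {w // T w < L w}, ∃ a ∈ A, T (w.1 ++ [a]) < L (w.1 ++ [a]) := fun w =>
    Finset.exists_lt_of_sum_lt ((hTsum w.1).trans_lt (w.2.trans_le (hL w.1)))
  choose d hdA hd using step
  let W : ℕ → {w // T w < L w} := fun n => Nat.rec ⟨[], hlt⟩ (fun _ w => ⟨w.1 ++ [d w], hd w⟩) n
  have hW : ∀ n, (W n).1 = (List.range n).map fun k => d (W k) := fun n => by
    induction n with
    | zero => rfl
    | succ n ih =>
      rw [List.range_succ, List.map_append, ← ih]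
      rfl
  obtain ⟨n, hn⟩ := hu (fun k => d (W k)) fun k => hdA _
  rw [← hW] at hn
  refine (W (u n).length).2.not_ge ?_
  rw [← hn]
  calc L (u n) = if u n <+: u n then L (u n) else 0 := by simp
    _ ≤ T (u n) := ENNReal.le_tsum n

/-! ### The geometry of cylinders -/

theorem act_singleton (a : ℕ+) (x : ℝ) : act [a] x = 1 / (((a : ℕ) : ℝ) + x) := rfl

/-- The map `x ↦ S · x` is a Möbius transformation; `t` is the ratio of the last two denominators
of the convergents of `S`, and `q` the square of the last one. -/
theorem exists_abs_act_sub_eq (S : List ℕ+) :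
    ∃ q t : ℝ, 0 < q ∧ t ∈ Icc (0 : ℝ) 1 ∧ ∀ x ∈ Icc (0 : ℝ) 1, ∀ y ∈ Icc (0 : ℝ) 1,
      |act S x - act S y| = |x - y| / (q * (1 + t * x) * (1 + t * y)) := by
  induction S using List.reverseRecOn with
  | nil => exact ⟨1, 0, one_pos, by simp, by simp [act]⟩
  | append_singleton S a ih =>
    obtain ⟨q, t, hq, ht, h⟩ := ih
    have ha := one_le_cast a
    have hat : 0 < ((a : ℕ) : ℝ) + t := by linarith [ht.1]
    refine ⟨q * (a + t) ^ 2, 1 / (a + t), by positivity, ⟨by positivity, ?_⟩, fun x hx y hy => ?_⟩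
    · rw [div_le_one hat]
      linarith [ht.1]
    rw [act_append, act_append, h _ (act_mem [a] hx) _ (act_mem [a] hy)]
    rw [act_singleton, act_singleton, abs_step _ _ _ ha hx.1 hy.1]
    have hax : 0 < ((a : ℕ) : ℝ) + x := by linarith [hx.1]
    have hay : 0 < ((a : ℕ) : ℝ) + y := by linarith [hy.1]
    have h1 : 0 < ((a : ℕ) : ℝ) + x + t := by linarith [ht.1]
    have h2 : 0 < ((a : ℕ) : ℝ) + y + t := by linarith [ht.1]
    have h3 : 0 < ((a : ℕ) : ℝ) + t + x := by linarith [ht.1]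
    have h4 : 0 < ((a : ℕ) : ℝ) + t + y := by linarith [ht.1]
    rw [div_div]
    congr 1
    field_simp
    ring

/-- The length of the cylinder of `S`, the interval `S · [0, 1]` of all reals that have an expansion
starting with `S`. -/
noncomputable def cylLength (S : List ℕ+) : ℝ := |act S 0 - act S 1|

theorem cylLength_nil : cylLength [] = 1 := by simp [cylLength, act]

theorem cylLength_le (S : List ℕ+) : cylLength S ≤ 2 * (1 / 2 : ℝ) ^ S.length :=
  abs_act_sub_le (by simp) (by simp) S

theorem cylLength_pos (S : List ℕ+) : 0 < cylLength S := by
  obtain ⟨q, t, hq, ht, h⟩ := exists_abs_act_sub_eq S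
  have := ht.1
  rw [cylLength, h 0 (by simp) 1 (by simp)]
  simp only [zero_sub, abs_neg, abs_one]
  positivity

theorem exists_cylLength_append_eq (S : List ℕ+) :
    ∃ q t : ℝ, 0 < q ∧ t ∈ Icc (0 : ℝ) 1 ∧ cylLength S = 1 / (q * (1 + t)) ∧
      ∀ a : ℕ+, cylLength (S ++ [a]) = 1 / (q * (a + t) * (a + 1 + t)) := by
  obtain ⟨q, t, hq, ht, h⟩ := exists_abs_act_sub_eq S
  refine ⟨q, t, hq, ht, ?_, fun a => ?_⟩
  · rw [cylLength, h 0 (by simp) 1 (by simp)]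
    simp
  · have ha := one_le_cast a
    rw [cylLength, act_append, act_append, h _ (act_mem [a] (by simp)) _ (act_mem [a] (by simp)),
      act_singleton, act_singleton, abs_step _ _ _ ha le_rfl zero_le_one]
    have h1 : 0 < ((a : ℕ) : ℝ) + t := by linarith [ht.1]
    have h2 : 0 < ((a : ℕ) : ℝ) + 1 + t := by linarith [ht.1]
    simp only [zero_sub, abs_neg, abs_one, add_zero]
    field_simp

theorem cylLength_append_le (S : List ℕ+) (a : ℕ+) :
    cylLength (S ++ [a]) ≤ cylLength S / 2 := by
  obtain ⟨q, t, hq, ht, h, h'⟩ := exists_cylLength_append_eq S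
  have ha := one_le_cast a
  have ht0 := ht.1
  rw [h, h', div_div]
  refine one_div_le_one_div_of_le (by positivity) ?_
  rw [mul_assoc, mul_assoc]
  refine mul_le_mul_of_nonneg_left ?_ hq.le
  exact mul_le_mul (by linarith) (by linarith) (by norm_num) (by linarith)

/-- The finite set of the digits `1, …, M`. -/
def digits (M : ℕ) : Finset ℕ+ := (Finset.range M).image Nat.succPNat

theorem mem_digits {M : ℕ} {a : ℕ+} : a ∈ digits M ↔ (a : ℕ) ≤ M := by
  simp only [digits, Finset.mem_image, Finset.mem_range]
  constructor
  · rintro ⟨k, hk, rfl⟩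
    simpa using hk
  · intro h
    have := a.pos
    exact ⟨a.natPred, by rw [← PNat.natPred_add_one a] at h; omega, PNat.succPNat_natPred a⟩

theorem sum_cylLength_append_ge (M : ℕ) (S : List ℕ+) :
    (1 - 2 / (M + 2)) * cylLength S ≤ ∑ a ∈ digits M, cylLength (S ++ [a]) := by
  obtain ⟨q, t, hq, ht, h, h'⟩ := exists_cylLength_append_eq S
  have ht0 := ht.1
  have hsum : ∑ a ∈ digits M, cylLength (S ++ [a]) = 1 / q * (1 / (1 + t) - 1 / (M + 1 + t)) := by
    rw [digits, Finset.sum_image Nat.succPNat_injective.injOn]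
    induction M with
    | zero => simp
    | succ M ih =>
      rw [Finset.sum_range_succ, ih, h']
      simp only [Nat.succPNat_coe, Nat.succ_eq_add_one, Nat.cast_add, Nat.cast_one]
      field_simp
      ring
  rw [hsum, h]
  have e : 1 / q * (1 / (1 + t) - 1 / (M + 1 + t))
      = (1 - (1 + t) / (M + 1 + t)) * (1 / (q * (1 + t))) := by
    field_simp
  rw [e]
  refine mul_le_mul_of_nonneg_right (sub_le_sub_left ?_ 1) (by positivity)
  rw [div_le_div_iff₀ (by positivity) (by positivity)]
  have hM : (0 : ℝ) ≤ M := M.cast_nonneg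
  nlinarith [ht.2]

/-- For `s < 1` and a large digit bound `M`, the `s`-th powers of the lengths of cylinders are
subadditive under subdivision. The subcylinders with digits up to `M` fill the cylinder up to a
small proportion, and each is at most half as long, so taking powers gains a factor `2 ^ (1 - s)`.
-/
theorem rpow_cylLength_le_sum {s : ℝ} (hs : s < 1) {M : ℕ}
    (hM : (2 : ℝ) ^ (s - 1) ≤ 1 - 2 / (M + 2)) (S : List ℕ+) :
    cylLength S ^ s ≤ ∑ a ∈ digits M, cylLength (S ++ [a]) ^ s := by
  have hpos := cylLength_pos S
  have h1 : ∀ a ∈ digits M, cylLength (S ++ [a]) * (cylLength S / 2) ^ (s - 1)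
      ≤ cylLength (S ++ [a]) ^ s := fun a _ => by
    have hp := cylLength_pos (S ++ [a])
    have : cylLength (S ++ [a]) ^ s = cylLength (S ++ [a]) * cylLength (S ++ [a]) ^ (s - 1) := by
      rw [Real.rpow_sub_one hp.ne']
      field_simp
    rw [this]
    exact mul_le_mul_of_nonneg_left
      (Real.rpow_le_rpow_of_nonpos hp (cylLength_append_le S a) (by linarith)) hp.le
  refine le_trans ?_ (Finset.sum_le_sum h1)
  rw [← Finset.sum_mul]
  refine le_trans ?_ (mul_le_mul_of_nonneg_right (sum_cylLength_append_ge M S) (by positivity))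
  rw [Real.div_rpow hpos.le zero_le_two]
  have h2 : (0 : ℝ) < 2 ^ (s - 1) := by positivity
  have h3 : cylLength S ^ s = cylLength S * cylLength S ^ (s - 1) := by
    rw [Real.rpow_sub_one hpos.ne']
    field_simp
  calc cylLength S ^ s = 2 ^ (s - 1) * (cylLength S * cylLength S ^ (s - 1) / 2 ^ (s - 1)) := by
        rw [h3]
        field_simp
    _ ≤ (1 - 2 / (M + 2)) * (cylLength S * cylLength S ^ (s - 1) / 2 ^ (s - 1)) :=
        mul_le_mul_of_nonneg_right hM (by positivity)
    _ = _ := by ring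

theorem inv_le_cfInfinite {M : ℕ} {a : ℕ → ℕ+} (ha : (a 0 : ℕ) ≤ M) :
    1 / ((M : ℝ) + 1) ≤ cfInfinite a := by
  have h := cfInfinite_mem_Ioo fun k => a (k + 1)
  have h1 := one_le_cast (a 0)
  have h2 : ((a 0 : ℕ) : ℝ) ≤ M := by exact_mod_cast ha
  rw [cfInfinite_succ]
  exact one_div_le_one_div_of_le (by linarith [h.1]) (by linarith [h.2])

/-- Two expansions with digits at most `M` that first differ after a common beginning `S` have
values whose distance is comparable to the length of the cylinder of `S`. -/
theorem cylLength_le_of_ne {M k : ℕ} {a b : ℕ → ℕ+} (ha : ∀ i, (a i : ℕ) ≤ M)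
    (hb : ∀ i, (b i : ℕ) ≤ M) (hab : ∀ i < k, a i = b i) (hk : a k ≠ b k) :
    cylLength ((List.range k).map a) ≤ 4 * (M + 2) ^ 3 * |cfInfinite a - cfInfinite b| := by
  have hS : (List.range k).map b = (List.range k).map a :=
    List.map_congr_left fun i hi => (hab i (List.mem_range.1 hi)).symm
  rw [cfInfinite_eq_act a k, cfInfinite_eq_act b k, hS]
  generalize (List.range k).map a = S
  -- The tails after the first difference are bounded away from `0` and `1`, so their sums with
  -- different integers are bounded away from each other.
  have key : ∀ c : ℕ → ℕ+, (∀ i, (c i : ℕ) ≤ M) →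
      cfInfinite c ∈ Icc (1 / ((M : ℝ) + 2)) (1 - 1 / (M + 2)) := fun c hc => by
    have hM : (0 : ℝ) ≤ M := M.cast_nonneg
    have h1 := inv_le_cfInfinite (hc 0)
    have h2 := inv_le_cfInfinite (M := M) (a := fun i => c (i + 1)) (hc _)
    have h3 := one_le_cast (c 0)
    refine ⟨(one_div_le_one_div_of_le (by linarith) (by linarith)).trans h1, ?_⟩
    rw [cfInfinite_succ]
    refine (one_div_le_one_div_of_le (by positivity) (add_le_add h3 h2)).trans (le_of_eq ?_)
    field_simp
    ring
  have hM : (0 : ℝ) ≤ M := M.cast_nonneg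
  obtain ⟨q, t, hq, ht, h⟩ := exists_abs_act_sub_eq S
  have hx := cfInfinite_mem_Icc fun i => a (i + k)
  have hy := cfInfinite_mem_Icc fun i => b (i + k)
  have hu := key (fun i => a (i + 1 + k)) fun i => ha _
  have hv := key (fun i => b (i + 1 + k)) fun i => hb _
  rw [cylLength, h 0 (by simp) 1 (by simp), h _ hx _ hy]
  have hd : 1 / ((M : ℝ) + 2) ^ 3 ≤
      |cfInfinite (fun i => a (i + k)) - cfInfinite fun i => b (i + k)| := by
    have hu0 := cfInfinite_mem_Icc fun i => a (i + 1 + k)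
    have hv0 := cfInfinite_mem_Icc fun i => b (i + 1 + k)
    rw [cfInfinite_succ fun i => a (i + k), cfInfinite_succ fun i => b (i + k)]
    simp only [zero_add]
    set u := cfInfinite fun i => a (i + 1 + k)
    set v := cfInfinite fun i => b (i + 1 + k)
    have hak := one_le_cast (a k)
    have hbk := one_le_cast (b k)
    have hak' : ((a k : ℕ) : ℝ) ≤ M := by exact_mod_cast ha k
    have hbk' : ((b k : ℕ) : ℝ) ≤ M := by exact_mod_cast hb k
    have e : 1 / (((a k : ℕ) : ℝ) + u) - 1 / (((b k : ℕ) : ℝ) + v)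
        = ((b k : ℕ) + v - ((a k : ℕ) + u)) / (((a k : ℕ) + u) * ((b k : ℕ) + v)) := by
      have : ((a k : ℕ) : ℝ) + u ≠ 0 := by linarith [hu0.1]
      have : ((b k : ℕ) : ℝ) + v ≠ 0 := by linarith [hv0.1]
      field_simp
    have hp : 0 < (((a k : ℕ) : ℝ) + u) * ((b k : ℕ) + v) :=
      mul_pos (by linarith [hu0.1]) (by linarith [hv0.1])
    rw [e, abs_div, abs_of_pos hp]
    have hnum : 1 / ((M : ℝ) + 2) ≤ |((b k : ℕ) : ℝ) + v - ((a k : ℕ) + u)| := by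
      have h2 : 0 ≤ 1 / ((M : ℝ) + 2) := by positivity
      rcases lt_or_gt_of_ne hk with hlt | hlt
      · have : ((a k : ℕ) : ℝ) + 1 ≤ (b k : ℕ) := by exact_mod_cast hlt
        exact le_trans (by linarith [hu.2, hv.1, hu.1]) (le_abs_self _)
      · have : ((b k : ℕ) : ℝ) + 1 ≤ (a k : ℕ) := by exact_mod_cast hlt
        exact le_trans (by linarith [hu.2, hv.1, hv.2, hu.1]) (neg_le_abs _)
    have hden : (((a k : ℕ) : ℝ) + u) * ((b k : ℕ) + v) ≤ ((M : ℝ) + 2) * (M + 2) :=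
      mul_le_mul (by linarith [hu0.2]) (by linarith [hv0.2]) (by linarith [hv0.1]) (by positivity)
    calc 1 / ((M : ℝ) + 2) ^ 3 = 1 / ((M : ℝ) + 2) / (((M : ℝ) + 2) * (M + 2)) := by
          field_simp
      _ ≤ _ := div_le_div₀ (abs_nonneg _) hnum hp hden
  set x := cfInfinite fun i => a (i + k)
  set y := cfInfinite fun i => b (i + k)
  have ht0 := ht.1
  have hx0 := hx.1
  have hy0 := hy.1
  have htx : 1 + t * x ≤ 2 := by nlinarith [mul_le_one₀ ht.2 hx.1 hx.2]
  have hty : 1 + t * y ≤ 2 := by nlinarith [mul_le_one₀ ht.2 hy.1 hy.2]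
  calc |(0 : ℝ) - 1| / (q * (1 + t * 0) * (1 + t * 1)) ≤ 1 / q := by
        simp only [zero_sub, abs_neg, abs_one, mul_zero, add_zero, mul_one]
        exact one_div_le_one_div_of_le hq (by nlinarith)
    _ = 4 * (M + 2) ^ 3 * (1 / ((M : ℝ) + 2) ^ 3 / (q * 2 * 2)) := by
        field_simp
        norm_num
    _ ≤ _ := by
        refine mul_le_mul_of_nonneg_left ?_ (by positivity)
        refine div_le_div₀ (abs_nonneg _) hd (by positivity) ?_
        exact mul_le_mul (mul_le_mul_of_nonneg_left htx hq.le) hty (by positivity) (by positivity)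

/-! ### The dimension of the set of reals with bounded digits -/

/-- The irrational reals in `(0, 1)` all of whose partial quotients are at most `M`. -/
def boundedDigits (M : ℕ) : Set ℝ := {x | ∃ a : ℕ → ℕ+, (∀ k, (a k : ℕ) ≤ M) ∧ cfInfinite a = x}

/-- The points of `boundedDigits M` in a given set lie in a cylinder not much longer than the
diameter of the set. The error `δ` takes care of sets with at most one such point. -/
theorem exists_cylinder_of_set (M : ℕ) {s : ℝ} (hs : 0 < s) (T : Set ℝ) {δ : ℝ≥0∞} (hδ : 0 < δ) :
    ∃ w : List ℕ+,
      (∀ a : ℕ → ℕ+, (∀ k, (a k : ℕ) ≤ M) → cfInfinite a ∈ T → w = (List.range w.length).map a) ∧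
      ENNReal.ofReal (cylLength w ^ s) ≤
        ENNReal.ofReal (4 * (M + 2) ^ 3) ^ s * Metric.ediam T ^ s + δ := by
  classical
  set P : Set (ℕ → ℕ+) := {a | (∀ k, (a k : ℕ) ≤ M) ∧ cfInfinite a ∈ T}
  by_cases hP : ∃ k, ∃ a ∈ P, ∃ b ∈ P, a k ≠ b k
  · obtain ⟨a, ha, b, hb, hk⟩ := Nat.find_spec hP
    have hmin : ∀ i < Nat.find hP, ∀ c ∈ P, c i = a i := fun i hi c hc => by
      by_contra hne
      exact Nat.find_min hP hi ⟨c, hc, a, ha, hne⟩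
    refine ⟨(List.range (Nat.find hP)).map a, fun c hc hcT => ?_, le_add_right ?_⟩
    · rw [List.length_map, List.length_range]
      exact List.map_congr_left fun i hi => (hmin i (List.mem_range.1 hi) c ⟨hc, hcT⟩).symm
    · have h := cylLength_le_of_ne ha.1 hb.1 (fun i hi => (hmin i hi b hb).symm) hk
      rw [← ENNReal.ofReal_rpow_of_pos (cylLength_pos _), ← ENNReal.mul_rpow_of_nonneg _ _ hs.le]
      refine ENNReal.rpow_le_rpow ?_ hs.le
      refine (ENNReal.ofReal_le_ofReal h).trans ?_
      rw [ENNReal.ofReal_mul (by positivity), ← Real.dist_eq, ← edist_dist]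
      gcongr
      exact Metric.edist_le_ediam_of_mem ha.2 hb.2
  · push Not at hP
    have hlim : Tendsto (fun n : ℕ => ENNReal.ofReal ((2 * (1 / 2 : ℝ) ^ n) ^ s)) atTop (𝓝 0) := by
      have h1 : Tendsto (fun n : ℕ => 2 * (1 / 2 : ℝ) ^ n) atTop (𝓝 0) := by
        simpa using (tendsto_pow_atTop_nhds_zero_of_lt_one (r := (1 / 2 : ℝ)) (by norm_num)
          (by norm_num)).const_mul 2
      have h2 := h1.rpow_const (p := s) (Or.inr hs.le)
      rw [Real.zero_rpow hs.ne'] at h2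
      simpa using ENNReal.tendsto_ofReal h2
    obtain ⟨n, hn⟩ := (hlim.eventually (gt_mem_nhds hδ)).exists
    have small : ∀ w : List ℕ+, w.length = n → ENNReal.ofReal (cylLength w ^ s) ≤ δ := by
      rintro w rfl
      refine le_trans (ENNReal.ofReal_le_ofReal ?_) hn.le
      exact Real.rpow_le_rpow (cylLength_pos w).le (cylLength_le w) hs.le
    rcases P.eq_empty_or_nonempty with hempty | ⟨a, ha⟩
    · refine ⟨List.replicate n 1, fun a ha haT => ?_, le_add_left (small _ (by simp))⟩
      exact absurd (show a ∈ P from ⟨ha, haT⟩) (by simp [hempty])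
    · refine ⟨(List.range n).map a, fun c hc hcT => ?_, le_add_left (small _ (by simp))⟩
      rw [List.length_map, List.length_range]
      exact List.map_congr_left fun i _ => hP i a ha c ⟨hc, hcT⟩

/-- A cover of `boundedDigits M` by small sets yields a cover by
cylinders, to which `le_tsum_of_cover` applies with the weight `cylLength ^ s`. -/
theorem le_dimH_boundedDigits {s : ℝ≥0} (hs0 : 0 < s) (hs1 : s < 1) {M : ℕ}
    (hM : (2 : ℝ) ^ ((s : ℝ) - 1) ≤ 1 - 2 / (M + 2)) : (s : ℝ≥0∞) ≤ dimH (boundedDigits M) := by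
  have hs : (0 : ℝ) < s := by exact_mod_cast hs0
  set C : ℝ≥0∞ := ENNReal.ofReal (4 * (M + 2) ^ 3) ^ (s : ℝ) with hC
  have hC0 : C ≠ 0 :=
    (ENNReal.rpow_pos (ENNReal.ofReal_pos.2 (by positivity)) ENNReal.ofReal_ne_top).ne'
  have hCtop : C ≠ ∞ := ENNReal.rpow_ne_top_of_nonneg hs.le ENNReal.ofReal_ne_top
  refine le_dimH_of_hausdorffMeasure_ne_zero (ne_of_gt ?_)
  refine (ENNReal.inv_pos.2 hCtop).trans_le ?_
  rw [Measure.hausdorffMeasure_apply]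
  refine le_iSup₂_of_le 1 one_pos (le_iInf fun t => le_iInf fun ht => le_iInf fun _ => ?_)
  rw [ENNReal.inv_le_iff_le_mul (fun _ => hC0) fun h => absurd h hCtop]
  refine ENNReal.le_of_forall_pos_le_add fun ε hε _ => ?_
  obtain ⟨δ, hδ, hδε⟩ := ENNReal.exists_pos_sum_of_countable' (ENNReal.coe_pos.2 hε).ne' ℕ
  choose w hw hwδ using fun n => exists_cylinder_of_set M hs (t n) (hδ n)
  have hcover := le_tsum_of_cover (digits M) (fun v => ENNReal.ofReal (cylLength v ^ (s : ℝ)))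
    (fun v => ?_) w fun x hx => ?_
  · rw [cylLength_nil, Real.one_rpow, ENNReal.ofReal_one] at hcover
    calc 1 ≤ ∑' n, ENNReal.ofReal (cylLength (w n) ^ (s : ℝ)) := hcover
      _ ≤ ∑' n, (C * (⨆ _ : (t n).Nonempty, Metric.ediam (t n) ^ (s : ℝ)) + δ n) := by
        refine ENNReal.tsum_le_tsum fun n => (hwδ n).trans ?_
        gcongr
        rcases (t n).eq_empty_or_nonempty with h | h
        · simp [h, hs]
        · exact le_iSup (fun _ : (t n).Nonempty => Metric.ediam (t n) ^ (s : ℝ)) h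
      _ ≤ _ := by
        rw [ENNReal.tsum_add, ENNReal.tsum_mul_left]
        gcongr
  · rw [← ENNReal.ofReal_sum_of_nonneg fun a _ => by have := cylLength_pos (v ++ [a]); positivity]
    exact ENNReal.ofReal_le_ofReal (rpow_cylLength_le_sum (by exact_mod_cast hs1) hM v)
  · have hx' := fun k => mem_digits.1 (hx k)
    obtain ⟨n, hn⟩ := mem_iUnion.1 (ht ⟨x, hx', rfl⟩)
    exact ⟨n, hw n x hx' hn⟩

/-! ### Untuned parameters -/

/-- A real with first digit `M + 3` and all other digits at most `M` lies in no tuning window: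
otherwise `x = S · y` with `y ≤ α₀`, where `S` is one of the two expansions of `r`; but the first
digit of `x` forces `α₀` to be small, while `y` is a proper tail of `x` and has a small first
digit. -/
theorem notMem_tuningWindow {M : ℕ} {a : ℕ → ℕ+} (h0 : (a 0 : ℕ) = M + 3)
    (ha : ∀ k, (a (k + 1) : ℕ) ≤ M) {r : ℚ} (hr : 0 < r) : cfInfinite a ∉ tuningWindow r := by
  rintro ⟨S₀, S₁, ⟨-, hodd, h₀, h₁⟩, hω, hα⟩
  rw [cfInfinite_prepend] at hω
  set α := cfInfinite (periodic S₀) with hα_def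
  have hαmem := cfInfinite_mem_Icc (periodic S₀)
  have hα0 : α = act S₀ α := cfInfinite_periodic S₀
  have hr' : (0 : ℝ) < r := by exact_mod_cast hr
  have hS₀ : S₀ ≠ [] := by
    rintro rfl
    exact hr'.ne h₀
  have hS₁ : S₁ ≠ [] := by
    rintro rfl
    simp at hodd
  have hcont : ∀ S : List ℕ+, ContinuousOn (act S) (Icc 0 α) := fun S =>
    (continuousOn_act S).mono (Icc_subset_Icc_right hαmem.2)
  obtain ⟨S, hS, hSr, y, hy, hxy⟩ : ∃ S : List ℕ+, S ≠ [] ∧ cfFinite S = r ∧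
      ∃ y ∈ Icc 0 α, act S y = cfInfinite a := by
    rcases le_total (cfInfinite a) r with hle | hle
    · exact ⟨S₁, hS₁, h₁, intermediate_value_Icc' hαmem.1 (hcont S₁) ⟨hω, hle.trans_eq h₁.symm⟩⟩
    · refine ⟨S₀, hS₀, h₀, intermediate_value_Icc hαmem.1 (hcont S₀) ⟨h₀.le.trans hle, ?_⟩⟩
      exact hα.le.trans_eq hα0
  obtain ⟨hdig, hytail⟩ := eq_of_cfInfinite_eq_act S a ⟨hy.1, hy.2.trans hαmem.2⟩ hxy.symm
  obtain ⟨b, S, rfl⟩ := List.exists_cons_of_ne_nil hS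
  obtain ⟨c, T, rfl⟩ := List.exists_cons_of_ne_nil hS₀
  have hb : a 0 = b := by
    rw [List.length_cons, List.range_succ_eq_map] at hdig
    exact (List.cons.inj hdig).1
  have hylow : 1 / ((M : ℝ) + 1) ≤ y := by
    rw [hytail]
    refine inv_le_cfInfinite ?_
    rw [List.length_cons, zero_add]
    exact ha _
  -- Both expansions of `r` give `r = 1 / (b + s) = 1 / (c + t)` with `s` and `t` in `[0, 1]`.
  have hs := act_mem S (x := 0) (by simp)
  have ht := act_mem T (x := 0) (by simp)
  have hbc : ((M : ℝ) + 2) ≤ (c : ℕ) := by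
    have e : act (b :: S) 0 = act (c :: T) 0 := hSr.trans h₀.symm
    rw [act_cons, act_cons, one_div, one_div, inv_inj, ← hb, h0] at e
    push_cast at e
    linarith [hs.1, ht.2]
  have hαup : α ≤ 1 / ((M : ℝ) + 2) := by
    rw [hα0, act_cons]
    exact one_div_le_one_div_of_le (by positivity) (by linarith [(act_mem T hαmem).1])
  have hlt : 1 / ((M : ℝ) + 2) < 1 / ((M : ℝ) + 1) :=
    one_div_lt_one_div_of_lt (by positivity) (by linarith)
  linarith [hy.2]

theorem inv_add_mem_untuned {M : ℕ} {x : ℝ} (hx : x ∈ boundedDigits M) :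
    1 / ((M : ℝ) + 3 + x) ∈ untuned := by
  obtain ⟨a, ha, rfl⟩ := hx
  have h := cfInfinite_mem_Ioo a
  set N : ℕ+ := ⟨M + 3, by omega⟩ with hN
  have e : 1 / ((M : ℝ) + 3 + cfInfinite a) = cfInfinite (prepend [N] a) := by
    rw [cfInfinite_prepend, act_singleton]
    simp [hN]
  refine ⟨⟨by have := h.1; positivity, ?_⟩, ?_⟩
  · have hg : (1 / 2 : ℝ) ≤ g := by
      have : (2 : ℝ) ≤ Real.sqrt 5 := Real.le_sqrt_of_sq_le (by norm_num)
      rw [g]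
      linarith
    refine (one_div_le_one_div_of_le zero_lt_two ?_).trans hg
    have : (0 : ℝ) ≤ M := M.cast_nonneg
    linarith [h.1]
  · rw [e]
    simp only [mem_iUnion, not_exists]
    intro r hr
    refine notMem_tuningWindow (M := M) rfl (fun k => ?_) hr.1
    simpa [prepend] using ha k

theorem dimH_boundedDigits_le_dimH_untuned (M : ℕ) : dimH (boundedDigits M) ≤ dimH untuned := by
  set N : ℝ := (M : ℝ) + 3
  set f : ℝ → ℝ := fun x => 1 / (N + x)
  have hN : 0 < N := by positivity
  have hpos : ∀ x ∈ boundedDigits M, 0 ≤ x := by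
    rintro _ ⟨a, -, rfl⟩
    exact (cfInfinite_mem_Icc a).1
  have hle : ∀ x ∈ boundedDigits M, x ≤ 1 := by
    rintro _ ⟨a, -, rfl⟩
    exact (cfInfinite_mem_Icc a).2
  have hlip : LipschitzOnWith (Real.toNNReal ((N + 1) ^ 2)) (fun u => 1 / u - N)
      (f '' boundedDigits M) := by
    refine LipschitzOnWith.of_dist_le_mul ?_
    rintro _ ⟨x, hx, rfl⟩ _ ⟨y, hy, rfl⟩
    have hx0 := hpos x hx
    have hy0 := hpos y hy
    have e : 1 / (N + x) - 1 / (N + y) = (y - x) / ((N + x) * (N + y)) := by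
      field_simp
      ring
    have hp : 0 < (N + x) * (N + y) := by positivity
    rw [Real.coe_toNNReal _ (by positivity), Real.dist_eq, Real.dist_eq, e, abs_div,
      abs_of_pos hp, one_div_one_div, one_div_one_div, mul_div_assoc', le_div_iff₀ hp,
      abs_sub_comm y x, show N + x - N - (N + y - N) = x - y by ring, mul_comm]
    refine mul_le_mul_of_nonneg_right ?_ (abs_nonneg _)
    nlinarith [hle x hx, hle y hy]
  have himage : (fun u => 1 / u - N) '' (f '' boundedDigits M) = boundedDigits M := by
    rw [image_image]
    simp [f]
  calc dimH (boundedDigits M) = dimH ((fun u => 1 / u - N) '' (f '' boundedDigits M)) := by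
        rw [himage]
    _ ≤ dimH (f '' boundedDigits M) := hlip.dimH_image_le
    _ ≤ dimH untuned := dimH_mono (image_subset_iff.2 fun x hx => inv_add_mem_untuned hx)

end AlphaCF

/-- The set of untuned parameters has Hausdorff dimension `1`. -/
theorem mainTheorem9 : dimH AlphaCF.untuned = 1 := by
  refine le_antisymm ((dimH_mono (subset_univ _)).trans_eq Real.dimH_univ) ?_
  refine le_of_forall_lt fun c hc => ?_
  obtain ⟨s, hcs, hs1⟩ := ENNReal.lt_iff_exists_nnreal_btwn.1 hc
  have hs0 : 0 < s := by exact_mod_cast (zero_le (a := c)).trans_lt hcs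
  have hs1' : s < 1 := by exact_mod_cast hs1
  have hpow : (2 : ℝ) ^ ((s : ℝ) - 1) < 1 :=
    Real.rpow_lt_one_of_one_lt_of_neg one_lt_two (sub_neg.2 (by exact_mod_cast hs1'))
  have hlim : Tendsto (fun M : ℕ => 1 - 2 / ((M : ℝ) + 2)) atTop (𝓝 1) := by
    have : Tendsto (fun M : ℕ => 2 / ((M : ℝ) + 2)) atTop (𝓝 0) :=
      tendsto_const_nhds.div_atTop (tendsto_atTop_add_const_right _ _ tendsto_natCast_atTop_atTop)
    simpa using this.const_sub 1
  obtain ⟨M, hM⟩ := (hlim.eventually (lt_mem_nhds hpow)).exists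
  exact hcs.trans_le ((AlphaCF.le_dimH_boundedDigits hs0 hs1' hM.le).trans
    (AlphaCF.dimH_boundedDigits_le_dimH_untuned M))
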